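/- Let $\|\cdot\|$ denote the Euclidean norm of vectors and the spectral norm of matrices. Let $D=\operatorname{diag}(\lambda_1,\dots,\lambda_n)\in\mathbb C^{n\times n}$ have pairwise distinct diagonal entries, let $B\in\mathbb C^{n\times n}$ have zero diagonal, and let $E=DB-BD$ (so $E$ has zero diagonal as well). Fix $i$ and put $$\eta_i=\min_{j\ne i}|\lambda_i-\lambda_j|,\qquad \rho_i=\frac{\|E\|}{\eta_i}$$ (for $n=1$, where $E=0$, read $\rho_i=0$ and $\|E\|^2/\eta_i=0$). A perturbed eigenvalue $\lambda_i(t)$, $t\in[0,1]$, is a continuous function on $[0,1]$ with $\lambda_i(0)=\lambda_i$ such that $\lambda_i(t)$ is an eigenvalue of $D+tE$ for every $t\in[0,1]$. Write $B(i,:)$ and $B(:,i)$ for the $i$-th row and the $i$-th column of $B$. (a) If $1-2\rho_i>0$ and $1-2\rho_i-\frac{\|B(i,:)\|\,\|B(:,i)\|}{1-2\rho_i}>0$, then a perturbed eigenvalue exists, and every perturbed eigenvalue satisfies, for all $t\in[0,1]$, $$|\lambda_i(t)-\lambda_i|\le \mathcal B_i(t):=\frac{t^2\|E\|\,\frac{\|B(i,:)\|+\|B(:,i)\|}{2}+\frac{t^3\|E\|\,\|B(i,:)\|\,\|B(:,i)\|}{3\left(1-\frac{2\|E\|}{\eta_i}\right)}}{1-\frac{2\|E\|}{\eta_i}-\frac{\|B(i,:)\|\,\|B(:,i)\|}{1-\frac{2\|E\|}{\eta_i}}}.$$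 (b) If $1-2\rho_i>0$ and $1-2\rho_i-\frac{\rho_i^2}{1-2\rho_i}>0$ (equivalently, $\rho_i<1/3$), then the hypotheses of (a) hold and, for all $t\in[0,1]$, $$\mathcal B_i(t)\le\frac{t^2\|E\|\left(\rho_i+\frac t3\,\frac{\rho_i^2}{1-2\rho_i}\right)}{1-2\rho_i-\frac{\rho_i^2}{1-2\rho_i}} \qquad\text{and}\qquad |\lambda_i(t)-\lambda_i|\le\frac{t^2\|E\|\left(\rho_i+\frac t3\,\frac{\rho_i^2}{1-\rho_i}\right)}{1-2\rho_i-\frac{\rho_i^2}{1-2\rho_i}}.$$ (c) In particular the perturbation is of order $\|E\|^2/\eta_i$: if $\rho_i\le r<1/3$, then for all $t\in[0,1]$ $$|\lambda_i(t)-\lambda_i|\le\frac{1+\frac13\,\frac{r}{1-r}}{1-2r-\frac{r^2}{1-2r}}\;t^2\,\frac{\|E\|^2}{\eta_i}.$$ -/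

import Mathlib

/- The norm on square complex matrices is the spectral norm (operator norm induced by the
Euclidean vector norm). -/
open scoped Matrix.Norms.L2Operator

/-- Spectral gap of the `i`-th entry of `d`: the minimum of `|d i - d j|` over `j ≠ i`. -/
noncomputable def spectralGap {n : ℕ} (d : Fin n → ℂ) (i : Fin n) : ℝ :=
  ⨅ j : {j : Fin n // j ≠ i}, ‖d i - d j‖

/-- Euclidean norm of the row `B(i,:)`. -/
noncomputable def rowNorm {n : ℕ} (B : Matrix (Fin n) (Fin n) ℂ) (i : Fin n) : ℝ :=
  ‖WithLp.toLp 2 (fun j => B i j)‖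

/-- Euclidean norm of the column `B(:,i)`. -/
noncomputable def colNorm {n : ℕ} (B : Matrix (Fin n) (Fin n) ℂ) (i : Fin n) : ℝ :=
  ‖WithLp.toLp 2 (fun j => B j i)‖

/-- `lam` is, on `[0,1]`, a perturbation of the `i`-th eigenvalue of `D = diagonal d` along
`D + tE`: it is continuous, starts at `d i`, and `lam t` is an eigenvalue of `D + tE`. -/
structure IsPerturbedEigenvalue {n : ℕ} (d : Fin n → ℂ) (E : Matrix (Fin n) (Fin n) ℂ)
    (i : Fin n) (lam : ℝ → ℂ) : Prop where
  continuousOn : ContinuousOn lam (Set.Icc 0 1)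
  initial : lam 0 = d i
  eigenvalue : ∀ t ∈ Set.Icc (0 : ℝ) 1,
    Module.End.HasEigenvalue (Matrix.toLin' (Matrix.diagonal d + (t : ℂ) • E)) (lam t)

/-! Write an eigenvalue of `D + tE` as `d i + δ` and its eigenvector as `e_i + w` with `w i = 0`.
The rows `k ≠ i` form a linear system for `w`, and since `E i i = 0` row `i` becomes the scalar
equation `δ = t (E w) i`. While `‖δ‖ + t‖E‖ ≤ κ η` with `κ = 2‖E‖/η < 1`, the reduced system is a
perturbation of `diag(d i - d k)` and costs a factor `1/(1 - κ)`. As `E = DB - BD`, the gaps can be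
moved from `E` onto `w`, which bounds `(E w) i` by the row of `B`, or cancelled in the right hand
side, which bounds it by the column (`IsReducedSolution.norm_mulVec_apply_le`). Averaging gives `‖δ‖
≤ t² ‖E‖ (row + col) / (2 (1 - κ))`, sharper than every stated bound: the cubic terms are
nonnegative and the subtracted quotients only shrink the denominators. The a priori bound `‖δ‖ ≤
‖E‖` follows from continuity, because the spectrum avoids an annulus around `d i`. Existence is a
fixed point problem in `δ` on the ball of radius `‖E‖`, with contraction constant `row * col / (1 -
κ)²`; the second hypothesis of (a) says that it is below `1`. -/

open scoped Topology NNReal in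
/-- The fixed points of a continuous family of uniform contractions form a continuous family. -/
theorem exists_continuousOn_fixedPoint {T X : Type*} [TopologicalSpace T] [MetricSpace X]
    {K : Set T} {s : Set X} (hs : IsComplete s) (hne : s.Nonempty) {q : ℝ≥0} (hq : q < 1)
    (F : T → X → X) (hmaps : ∀ t ∈ K, Set.MapsTo (F t) s s)
    (hlip : ∀ t ∈ K, LipschitzOnWith q (F t) s)
    (hcont : ∀ z ∈ s, ContinuousOn (fun t => F t z) K) :
    ∃ x : T → X, ContinuousOn x K ∧ ∀ t ∈ K, x t ∈ s ∧ F t (x t) = x t := by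
  have hex : ∀ t, ∃ x, t ∈ K → x ∈ s ∧ F t x = x := by
    intro t
    obtain ⟨z, hz⟩ := hne
    by_cases ht : t ∈ K
    · have hc : ContractingWith q ((hmaps t ht).restrict (F t) s s) :=
        ⟨hq, (hlip t ht).mapsToRestrict (hmaps t ht)⟩
      obtain ⟨y, hy, hfix, -⟩ := hc.exists_fixedPoint' hs (hmaps t ht) hz (edist_ne_top _ _)
      exact ⟨y, fun _ => ⟨hy, hfix⟩⟩
    · exact ⟨z, fun h => absurd h ht⟩
  choose x hx using hex
  refine ⟨x, fun t₀ ht₀ => ?_, fun t ht => hx t ht⟩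
  have hq' : (q : ℝ) < 1 := by exact_mod_cast hq
  -- Contractivity gives `dist (x t) (x t₀) ≤ dist (F t (x t₀)) (x t₀) / (1 - q)`, so continuity of
  -- `F` in `t` at the single point `x t₀` suffices.
  have hlim := (tendsto_iff_dist_tendsto_zero.1 (hcont (x t₀) (hx t₀ ht₀).1 t₀ ht₀)).const_mul
    ((1 - (q : ℝ))⁻¹)
  rw [mul_zero] at hlim
  refine tendsto_iff_dist_tendsto_zero.2 (squeeze_zero' (.of_forall fun _ => dist_nonneg) ?_ hlim)
  filter_upwards [self_mem_nhdsWithin] with t ht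
  have h1 := (hlip t ht).dist_le_mul _ (hx t ht).1 _ (hx t₀ ht₀).1
  have h2 := dist_triangle (F t (x t)) (F t (x t₀)) (F t₀ (x t₀))
  rw [(hx t ht).2] at h1 h2
  rw [(hx t₀ ht₀).2] at h2 ⊢
  rw [inv_mul_eq_div, le_div_iff₀ (by linarith)]
  linarith

/-! ### Euclidean norm estimates -/

section EuclideanNorm

variable {ι : Type*} [Fintype ι]

/-- The Euclidean norm of a complex vector. -/
noncomputable def euclNorm (v : ι → ℂ) : ℝ := ‖WithLp.toLp 2 v‖

theorem euclNorm_nonneg (v : ι → ℂ) : 0 ≤ euclNorm v := norm_nonneg _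

theorem euclNorm_add_le (u v : ι → ℂ) : euclNorm (u + v) ≤ euclNorm u + euclNorm v :=
  norm_add_le (WithLp.toLp 2 u) (WithLp.toLp 2 v)

theorem euclNorm_smul (c : ℂ) (v : ι → ℂ) : euclNorm (c • v) = ‖c‖ * euclNorm v :=
  norm_smul c (WithLp.toLp 2 v)

theorem euclNorm_mono {u v : ι → ℂ} (h : ∀ k, ‖u k‖ ≤ ‖v k‖) : euclNorm u ≤ euclNorm v := by
  rw [euclNorm, euclNorm, EuclideanSpace.norm_eq, EuclideanSpace.norm_eq]
  exact Real.sqrt_le_sqrt (Finset.sum_le_sum fun k _ => by gcongr; exact h k)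

theorem euclNorm_le_mul {u v : ι → ℂ} {c : ℝ} (hc : 0 ≤ c) (h : ∀ k, ‖u k‖ ≤ c * ‖v k‖) :
    euclNorm u ≤ c * euclNorm v := by
  have : euclNorm u ≤ euclNorm ((c : ℂ) • v) :=
    euclNorm_mono fun k => by simpa [abs_of_nonneg hc] using h k
  rwa [euclNorm_smul, Complex.norm_real, Real.norm_of_nonneg hc] at this

theorem norm_apply_le_euclNorm (v : ι → ℂ) (k : ι) : ‖v k‖ ≤ euclNorm v :=
  PiLp.norm_apply_le (WithLp.toLp 2 v) k

theorem eq_zero_of_euclNorm_le_zero {v : ι → ℂ} (h : euclNorm v ≤ 0) : v = 0 := by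
  funext k
  exact norm_le_zero_iff.1 ((norm_apply_le_euclNorm v k).trans h)

theorem norm_dotProduct_le (u v : ι → ℂ) : ‖u ⬝ᵥ v‖ ≤ euclNorm u * euclNorm v := by
  rw [euclNorm, euclNorm, EuclideanSpace.norm_eq, EuclideanSpace.norm_eq]
  calc ‖u ⬝ᵥ v‖ ≤ ∑ k, ‖u k‖ * ‖v k‖ :=
        (norm_sum_le _ _).trans (Finset.sum_le_sum fun k _ => (norm_mul _ _).le)
    _ ≤ _ := Real.sum_mul_le_sqrt_mul_sqrt _ _ _

variable [DecidableEq ι]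

theorem euclNorm_mulVec_le (A : Matrix ι ι ℂ) (v : ι → ℂ) :
    euclNorm (A.mulVec v) ≤ ‖A‖ * euclNorm v :=
  Matrix.l2_opNorm_mulVec A (WithLp.toLp 2 v)

theorem euclNorm_col_le (A : Matrix ι ι ℂ) (i : ι) : euclNorm (fun k => A k i) ≤ ‖A‖ := by
  have h := euclNorm_mulVec_le A (Pi.single i 1)
  have h1 : euclNorm (Pi.single i (1 : ℂ)) = 1 := by simp [euclNorm]
  rw [Matrix.mulVec_single_one, h1, mul_one] at h
  exact h

theorem euclNorm_row_le (A : Matrix ι ι ℂ) (i : ι) : euclNorm (A i) ≤ ‖A‖ := by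
  have h := euclNorm_col_le A.conjTranspose i
  rw [Matrix.l2_opNorm_conjTranspose] at h
  exact (euclNorm_mono fun k => by simp).trans h

end EuclideanNorm

/-! ### The reduced system for an eigenvector -/

section Eigenvalue

variable {ι : Type*} [Fintype ι] [DecidableEq ι] {d : ι → ℂ} {E B : Matrix ι ι ℂ} {i : ι} {η κ : ℝ}

/-- `w` vanishes at `i` and solves the rows other than `i` of
`(d i + δ - diagonal d - τ E) w = g`. -/
structure IsReducedSolution (d : ι → ℂ) (E : Matrix ι ι ℂ) (i : ι) (τ δ : ℂ) (g w : ι → ℂ) :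
    Prop where
  apply_self : w i = 0
  apply_of_ne : ∀ k, k ≠ i → (d i - d k + δ) * w k - τ * E.mulVec w k = g k

namespace IsReducedSolution

variable {τ δ : ℂ} {g w : ι → ℂ}

-- The resolvent identity in vector form; it turns Lipschitz dependence on `δ` into the estimate for
-- one system.
omit [DecidableEq ι] in
theorem sub {δ' : ℂ} {w' : ι → ℂ} (h : IsReducedSolution d E i τ δ g w)
    (h' : IsReducedSolution d E i τ δ' g w') :
    IsReducedSolution d E i τ δ ((δ' - δ) • w') (w - w') where
  apply_self := by simp [h.apply_self, h'.apply_self]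
  apply_of_ne k hk := by
    have h1 := h.apply_of_ne k hk
    have h2 := h'.apply_of_ne k hk
    simp only [Matrix.mulVec_sub, Pi.sub_apply, Pi.smul_apply, smul_eq_mul]
    linear_combination h1 - h2

theorem euclNorm_remainder_le (hκ : ‖δ‖ + ‖τ‖ * ‖E‖ ≤ κ * η) (w : ι → ℂ) :
    euclNorm ((-δ) • w + τ • E.mulVec w) ≤ κ * (η * euclNorm w) := by
  refine (euclNorm_add_le _ _).trans ?_
  rw [euclNorm_smul, euclNorm_smul, norm_neg]
  have h1 := mul_le_mul_of_nonneg_left (euclNorm_mulVec_le E w) (norm_nonneg τ)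
  have h2 := mul_le_mul_of_nonneg_right hκ (euclNorm_nonneg w)
  linarith

/-- The terms in `δ` and `τ E` are at most `κ η ‖w‖`, and `η ‖w‖` is bounded by the gap-weighted
norm, so they are absorbed on the left. -/
theorem euclNorm_mul_le (hη : 0 < η) (hd : ∀ k, k ≠ i → η ≤ ‖d i - d k‖)
    (hκ0 : 0 ≤ κ) (hκ : ‖δ‖ + ‖τ‖ * ‖E‖ ≤ κ * η) (h : IsReducedSolution d E i τ δ g w) :
    (1 - κ) * euclNorm (fun k => (d i - d k) * w k) ≤ euclNorm g := by
  have h1 : euclNorm w ≤ η⁻¹ * euclNorm (fun k => (d i - d k) * w k) := by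
    refine euclNorm_le_mul (by positivity) fun k => ?_
    rw [inv_mul_eq_div, le_div_iff₀ hη, norm_mul, mul_comm]
    rcases eq_or_ne k i with rfl | hk
    · simp [h.apply_self]
    · exact mul_le_mul_of_nonneg_right (hd k hk) (norm_nonneg _)
  have h2 : euclNorm (fun k => (d i - d k) * w k) ≤
      euclNorm (g + ((-δ) • w + τ • E.mulVec w)) := by
    refine euclNorm_mono fun k => ?_
    rcases eq_or_ne k i with rfl | hk
    · simp
    · refine le_of_eq (congrArg _ ?_)
      simp only [Pi.add_apply, Pi.smul_apply, smul_eq_mul, ← h.apply_of_ne k hk]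
      ring
  have h3 := euclNorm_add_le g ((-δ) • w + τ • E.mulVec w)
  have h4 := euclNorm_remainder_le hκ w
  rw [inv_mul_eq_div, le_div_iff₀ hη, mul_comm] at h1
  have h5 := mul_le_mul_of_nonneg_left h1 hκ0
  linarith

/-- The same absorption after dividing row `k` by `d i - d k`. A right hand side containing this
factor then loses it, and no power of `1/η` appears. -/
theorem euclNorm_le (hη : 0 < η) (hd : ∀ k, k ≠ i → η ≤ ‖d i - d k‖)
    (hκ : ‖δ‖ + ‖τ‖ * ‖E‖ ≤ κ * η) {f : ι → ℂ} (hg : ∀ k, k ≠ i → g k = (d i - d k) * f k)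
    (h : IsReducedSolution d E i τ δ g w) :
    (1 - κ) * euclNorm w ≤ euclNorm f := by
  set u := (-δ) • w + τ • E.mulVec w with hu
  have h1 : euclNorm (fun k => (d i - d k)⁻¹ * u k) ≤ η⁻¹ * euclNorm u := by
    refine euclNorm_le_mul (by positivity) fun k => ?_
    rw [norm_mul, norm_inv]
    rcases eq_or_ne k i with rfl | hk
    · simp only [sub_self, norm_zero, inv_zero, zero_mul]; positivity
    · gcongr
      exact hd k hk
  have h2 : euclNorm w ≤ euclNorm (f + fun k => (d i - d k)⁻¹ * u k) := by
    refine euclNorm_mono fun k => ?_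
    rcases eq_or_ne k i with rfl | hk
    · simp [h.apply_self]
    · have hne : d i - d k ≠ 0 := norm_pos_iff.1 (hη.trans_le (hd k hk))
      refine le_of_eq (congrArg _ ?_)
      have := h.apply_of_ne k hk
      rw [hg k hk] at this
      simp only [hu, Pi.add_apply, Pi.smul_apply, smul_eq_mul]
      field_simp
      linear_combination this
  have h3 := euclNorm_add_le f (fun k => (d i - d k)⁻¹ * u k)
  have h4 := euclNorm_remainder_le hκ w
  have h5 : η⁻¹ * euclNorm u ≤ κ * euclNorm w := by
    rw [inv_mul_eq_div, div_le_iff₀ hη]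
    linarith
  linarith

end IsReducedSolution

/-- The coefficient matrix of the preconditioned reduced system. -/
noncomputable def reducedMatrix (d : ι → ℂ) (E : Matrix ι ι ℂ) (i : ι) (τ δ : ℂ) : Matrix ι ι ℂ :=
  1 - Matrix.diagonal (fun k => (d i - d k)⁻¹) * (τ • E - δ • (1 : Matrix ι ι ℂ))

/-- The solution of the reduced system whose right hand side is `τ` times column `i` of `E`. -/
noncomputable def reducedVector (d : ι → ℂ) (E : Matrix ι ι ℂ) (i : ι) (τ δ : ℂ) : ι → ℂ :=
  (Ring.inverse (reducedMatrix d E i τ δ)).mulVec (fun k => (d i - d k)⁻¹ * (τ * E k i))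

/-- Neumann series: the preconditioner has norm at most `1/η`. -/
theorem isUnit_reducedMatrix (hη : 0 < η) (hd : ∀ k, k ≠ i → η ≤ ‖d i - d k‖) {τ δ : ℂ}
    (h : ‖δ‖ + ‖τ‖ * ‖E‖ < η) : IsUnit (reducedMatrix d E i τ δ) := by
  refine isUnit_one_sub_of_norm_lt_one ?_
  have h1 : ‖Matrix.diagonal (fun k => (d i - d k)⁻¹)‖ ≤ η⁻¹ := by
    rw [Matrix.l2_opNorm_diagonal]
    refine (pi_norm_le_iff_of_nonneg (by positivity)).2 fun k => ?_
    rw [norm_inv]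
    rcases eq_or_ne k i with rfl | hk
    · simp only [sub_self, norm_zero, inv_zero]; positivity
    · gcongr
      exact hd k hk
  have h2 : ‖τ • E - δ • (1 : Matrix ι ι ℂ)‖ ≤ ‖δ‖ + ‖τ‖ * ‖E‖ := by
    have : Nonempty ι := ⟨i⟩
    refine (norm_sub_le _ _).trans ?_
    rw [norm_smul, norm_smul, norm_one, mul_one, add_comm]
  calc _ ≤ _ := norm_mul_le _ _
    _ ≤ η⁻¹ * (‖δ‖ + ‖τ‖ * ‖E‖) := by gcongr
    _ < 1 := by rwa [inv_mul_eq_div, div_lt_one hη]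

theorem isReducedSolution_reducedVector (hη : 0 < η) (hd : ∀ k, k ≠ i → η ≤ ‖d i - d k‖) {τ δ : ℂ}
    (h : ‖δ‖ + ‖τ‖ * ‖E‖ < η) :
    IsReducedSolution d E i τ δ (fun k => τ * E k i) (reducedVector d E i τ δ) := by
  have hA : (reducedMatrix d E i τ δ).mulVec (reducedVector d E i τ δ) =
      fun k => (d i - d k)⁻¹ * (τ * E k i) := by
    rw [reducedVector, Matrix.mulVec_mulVec, Ring.mul_inverse_cancel _
      (isUnit_reducedMatrix hη hd h), Matrix.one_mulVec]
  set w := reducedVector d E i τ δ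
  have hk : ∀ k, w k - (d i - d k)⁻¹ * (τ * E.mulVec w k - δ * w k) =
      (d i - d k)⁻¹ * (τ * E k i) := fun k => by
    rw [← congrFun hA k, reducedMatrix, Matrix.sub_mulVec, ← Matrix.mulVec_mulVec,
      Matrix.one_mulVec, Pi.sub_apply, Matrix.mulVec_diagonal, Matrix.sub_mulVec,
      Matrix.smul_mulVec, Matrix.smul_mulVec, Matrix.one_mulVec]
    simp
  -- In row `i` the convention `0⁻¹ = 0` removes everything except `w i`, so the full matrix
  -- enforces `w i = 0`.
  refine ⟨by simpa using hk i, fun k hki => ?_⟩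
  have hne : d i - d k ≠ 0 := norm_pos_iff.1 (hη.trans_le (hd k hki))
  have := hk k
  field_simp at this
  linear_combination this

theorem continuousOn_reducedVector (hη : 0 < η) (hd : ∀ k, k ≠ i → η ≤ ‖d i - d k‖) {δ : ℂ}
    {K : Set ℂ} (h : ∀ τ ∈ K, ‖δ‖ + ‖τ‖ * ‖E‖ < η) :
    ContinuousOn (fun τ => reducedVector d E i τ δ) K := by
  intro τ hτ
  have hA : Continuous fun τ => reducedMatrix d E i τ δ := by
    unfold reducedMatrix
    fun_prop
  obtain ⟨u, hu⟩ := isUnit_reducedMatrix hη hd (h τ hτ)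
  have h1 : ContinuousAt (fun τ => Ring.inverse (reducedMatrix d E i τ δ)) τ := by
    refine ContinuousAt.comp (g := Ring.inverse) ?_ hA.continuousAt
    rw [← hu]
    exact NormedRing.inverse_continuousAt u
  refine ContinuousAt.continuousWithinAt ?_
  unfold reducedVector
  rw [continuousAt_pi]
  intro k
  simp only [Matrix.mulVec, dotProduct]
  have h2 : ∀ j, ContinuousAt (fun τ => Ring.inverse (reducedMatrix d E i τ δ) k j) τ := fun j =>
    (show Continuous fun A : Matrix ι ι ℂ => A k j by fun_prop).continuousAt.comp h1
  exact tendsto_finsetSum _ fun j _ => (h2 j).mul (by fun_prop)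

/-! ### Commutator structure and the coupling term -/

theorem commutator_diagonal_apply (hE : E = Matrix.diagonal d * B - B * Matrix.diagonal d)
    (j k : ι) : E j k = (d j - d k) * B j k := by
  simp [hE, Matrix.diagonal_mul, Matrix.mul_diagonal]
  ring

theorem commutator_diagonal_mulVec_apply
    (hE : E = Matrix.diagonal d * B - B * Matrix.diagonal d) (w : ι → ℂ) :
    E.mulVec w i = B i ⬝ᵥ fun k => (d i - d k) * w k := by
  simp only [Matrix.mulVec, dotProduct, commutator_diagonal_apply hE]
  exact Finset.sum_congr rfl fun k _ => by ring

/-- Both bounds for the coupling term of a solution of the reduced system. -/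
theorem IsReducedSolution.norm_mulVec_apply_le {τ δ c : ℂ} {w : ι → ℂ} (hη : 0 < η)
    (hd : ∀ k, k ≠ i → η ≤ ‖d i - d k‖) (hκ0 : 0 ≤ κ) (hκ1 : κ < 1)
    (hκ : ‖δ‖ + ‖τ‖ * ‖E‖ ≤ κ * η) (hE : E = Matrix.diagonal d * B - B * Matrix.diagonal d)
    (h : IsReducedSolution d E i τ δ (fun k => c * E k i) w) :
    (1 - κ) * ‖E.mulVec w i‖ ≤ ‖c‖ * (‖E‖ * euclNorm (B i)) ∧
    (1 - κ) * ‖E.mulVec w i‖ ≤ ‖c‖ * (‖E‖ * euclNorm (fun k => B k i)) ∧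
    (1 - κ) * euclNorm w ≤ ‖c‖ * euclNorm (fun k => B k i) := by
  have hw : (1 - κ) * euclNorm w ≤ ‖c‖ * euclNorm (fun k => B k i) := by
    have := h.euclNorm_le hη hd hκ (f := (-c) • fun k => B k i) fun k _ => by
      simp only [commutator_diagonal_apply hE k i, Pi.smul_apply, smul_eq_mul]
      ring
    rwa [euclNorm_smul, norm_neg] at this
  refine ⟨?_, ?_, hw⟩
  · have h1 := h.euclNorm_mul_le hη hd hκ0 hκ
    have h2 := norm_dotProduct_le (B i) fun k => (d i - d k) * w k
    rw [← commutator_diagonal_mulVec_apply hE] at h2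
    have h3 : euclNorm (fun k => c * E k i) ≤ ‖c‖ * ‖E‖ :=
      (euclNorm_smul c fun k => E k i).le.trans (by gcongr; exact euclNorm_col_le E i)
    calc _ ≤ (1 - κ) * (euclNorm (B i) * euclNorm fun k => (d i - d k) * w k) :=
          mul_le_mul_of_nonneg_left h2 (by linarith)
      _ = euclNorm (B i) * ((1 - κ) * euclNorm fun k => (d i - d k) * w k) := by ring
      _ ≤ euclNorm (B i) * (‖c‖ * ‖E‖) :=
          mul_le_mul_of_nonneg_left (h1.trans h3) (euclNorm_nonneg _)
      _ = _ := by ring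
  · calc _ ≤ (1 - κ) * (‖E‖ * euclNorm w) := mul_le_mul_of_nonneg_left
          ((norm_apply_le_euclNorm _ i).trans (euclNorm_mulVec_le E w)) (by linarith)
      _ = ‖E‖ * ((1 - κ) * euclNorm w) := by ring
      _ ≤ ‖E‖ * (‖c‖ * euclNorm fun k => B k i) := mul_le_mul_of_nonneg_left hw (norm_nonneg _)
      _ = _ := by ring

/-! ### Eigenvalues and the reduced system -/

theorem hasEigenvalue_diagonal_add_smul_iff {τ μ : ℂ} :
    Module.End.HasEigenvalue (Matrix.toLin' (Matrix.diagonal d + τ • E)) μ ↔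
      ∃ v : ι → ℂ, v ≠ 0 ∧ ∀ k, d k * v k + τ * E.mulVec v k = μ * v k := by
  have key : ∀ v : ι → ℂ, Matrix.toLin' (Matrix.diagonal d + τ • E) v = μ • v ↔
      ∀ k, d k * v k + τ * E.mulVec v k = μ * v k := fun v => by
    rw [Matrix.toLin'_apply, Matrix.add_mulVec, Matrix.smul_mulVec, funext_iff]
    simp [Matrix.mulVec_diagonal]
  constructor
  · intro h
    obtain ⟨v, hv⟩ := h.exists_hasEigenvector
    exact ⟨v, hv.2, (key v).1 hv.apply_eq_smul⟩
  · rintro ⟨v, hv0, hv⟩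
    exact Module.End.hasEigenvalue_of_hasEigenvector
      (Module.End.hasEigenvector_iff.2 ⟨Module.End.mem_eigenspace_iff.2 ((key v).2 hv), hv0⟩)

/-- Bauer–Fike for a diagonal matrix: `(μ - d j) v j = τ (E v) j`, so if `μ` were farther than
`‖τ‖‖E‖` from every `d j`, then `v = 0`. -/
theorem exists_norm_sub_le_of_hasEigenvalue {τ μ : ℂ}
    (h : Module.End.HasEigenvalue (Matrix.toLin' (Matrix.diagonal d + τ • E)) μ) :
    ∃ k, ‖μ - d k‖ ≤ ‖τ‖ * ‖E‖ := by
  obtain ⟨v, hv0, hv⟩ := hasEigenvalue_diagonal_add_smul_iff.1 h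
  have hne : Nonempty ι := by
    by_contra hc
    exact hv0 (funext fun k => (hc ⟨k⟩).elim)
  obtain ⟨k, hk⟩ := Finite.exists_min fun k => ‖μ - d k‖
  refine ⟨k, ?_⟩
  by_contra! hc
  have hpos : 0 < ‖μ - d k‖ := lt_of_le_of_lt (by positivity) hc
  have h1 : euclNorm v ≤ ‖μ - d k‖⁻¹ * euclNorm (τ • E.mulVec v) := by
    refine euclNorm_le_mul (by positivity) fun j => ?_
    have : (τ • E.mulVec v) j = (μ - d j) * v j := by
      simp only [Pi.smul_apply, smul_eq_mul]
      linear_combination hv j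
    rw [this, norm_mul, inv_mul_eq_div, le_div_iff₀ hpos, mul_comm]
    exact mul_le_mul_of_nonneg_right (hk j) (norm_nonneg _)
  rw [inv_mul_eq_div, le_div_iff₀ hpos, euclNorm_smul] at h1
  have h2 := mul_le_mul_of_nonneg_left (euclNorm_mulVec_le E v) (norm_nonneg τ)
  refine hv0 (eq_zero_of_euclNorm_le_zero ?_)
  nlinarith [euclNorm_nonneg v]

/-- An eigenvalue of `D + τ E` close to `d i` is close to second order. -/
theorem norm_eigenvalue_sub_le {τ μ : ℂ} (hη : 0 < η) (hd : ∀ k, k ≠ i → η ≤ ‖d i - d k‖)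
    (hκ0 : 0 ≤ κ) (hκ1 : κ < 1) (hκ : ‖μ - d i‖ + ‖τ‖ * ‖E‖ ≤ κ * η)
    (hE : E = Matrix.diagonal d * B - B * Matrix.diagonal d)
    (h : Module.End.HasEigenvalue (Matrix.toLin' (Matrix.diagonal d + τ • E)) μ) :
    (1 - κ) * ‖μ - d i‖ ≤ ‖τ‖ ^ 2 * (‖E‖ * euclNorm (B i)) ∧
    (1 - κ) * ‖μ - d i‖ ≤ ‖τ‖ ^ 2 * (‖E‖ * euclNorm (fun k => B k i)) := by
  obtain ⟨v, hv0, hv⟩ := hasEigenvalue_diagonal_add_smul_iff.1 h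
  set w := Function.update v i 0 with hw
  have hvw : v = w + v i • Pi.single i 1 := by
    funext k
    rcases eq_or_ne k i with rfl | hk <;> simp [*]
  have hmul : ∀ k, E.mulVec v k = E.mulVec w k + v i * E k i := fun k => by
    conv_lhs => rw [hvw, Matrix.mulVec_add, Matrix.mulVec_smul, Matrix.mulVec_single_one]
    simp
  have hsol : IsReducedSolution d E i τ (μ - d i) (fun k => (τ * v i) * E k i) w := by
    refine ⟨by simp [hw], fun k hk => ?_⟩
    have h1 := hv k
    rw [hmul] at h1
    have h2 : w k = v k := by simp [hw, hk]
    rw [h2]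
    linear_combination -h1
  obtain ⟨h1, h2, h3⟩ := hsol.norm_mulVec_apply_le hη hd hκ0 hκ1 hκ hE
  -- If `v i = 0`, the reduced system is homogeneous and forces `w = 0`, hence `v = 0`.
  have hvi : v i ≠ 0 := fun h0 => by
    rw [h0, mul_zero, norm_zero, zero_mul] at h3
    have : w = 0 := eq_zero_of_euclNorm_le_zero (by nlinarith [euclNorm_nonneg w])
    apply hv0
    rw [hvw, this, h0]
    simp
  have hpos : 0 < ‖v i‖ := norm_pos_iff.2 hvi
  have heq : ‖μ - d i‖ * ‖v i‖ = ‖τ‖ * ‖E.mulVec w i‖ := by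
    rw [← norm_mul, ← norm_mul]
    refine congrArg _ ?_
    have h4 := hv i
    rw [hmul, commutator_diagonal_apply hE i i] at h4
    linear_combination -h4
  rw [norm_mul] at h1 h2
  constructor
  · refine le_of_mul_le_mul_right ?_ hpos
    have := mul_le_mul_of_nonneg_left h1 (norm_nonneg τ)
    linear_combination this + (1 - κ) * heq
  · refine le_of_mul_le_mul_right ?_ hpos
    have := mul_le_mul_of_nonneg_left h2 (norm_nonneg τ)
    linear_combination this + (1 - κ) * heq

theorem hasEigenvalue_of_isReducedSolution {τ δ : ℂ} {w : ι → ℂ} (hEi : E i i = 0)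
    (h : IsReducedSolution d E i τ δ (fun k => τ * E k i) w) (hδ : τ * E.mulVec w i = δ) :
    Module.End.HasEigenvalue (Matrix.toLin' (Matrix.diagonal d + τ • E)) (d i + δ) := by
  refine hasEigenvalue_diagonal_add_smul_iff.2 ⟨w + Pi.single i 1, fun h0 => ?_, fun k => ?_⟩
  · have := congrFun h0 i
    simp [h.apply_self] at this
  · rw [Matrix.mulVec_add, Matrix.mulVec_single_one]
    rcases eq_or_ne k i with rfl | hk
    · simp [h.apply_self, hEi, hδ]
    · have := h.apply_of_ne k hk
      simp only [Pi.add_apply, Matrix.col_apply, Pi.single_eq_of_ne hk, add_zero]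
      linear_combination -this

end Eigenvalue

/-! ### Localization and existence of perturbed eigenvalues -/

theorem IsPerturbedEigenvalue.norm_sub_le {n : ℕ} {d : Fin n → ℂ} {E : Matrix (Fin n) (Fin n) ℂ}
    {i : Fin n} {η : ℝ} {lam : ℝ → ℂ} (hd : ∀ k, k ≠ i → η ≤ ‖d i - d k‖) (hE : 2 * ‖E‖ < η)
    (h : IsPerturbedEigenvalue d E i lam) {t : ℝ} (ht : t ∈ Set.Icc (0 : ℝ) 1) :
    ‖lam t - d i‖ ≤ ‖E‖ := by
  have hgap : ∀ s ∈ Set.Icc (0 : ℝ) 1, ‖lam s - d i‖ ≤ ‖E‖ ∨ η - ‖E‖ ≤ ‖lam s - d i‖ := by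
    intro s hs
    obtain ⟨k, hk⟩ := exists_norm_sub_le_of_hasEigenvalue (h.eigenvalue s hs)
    have hsE : ‖(s : ℂ)‖ * ‖E‖ ≤ ‖E‖ := by
      rw [Complex.norm_real, Real.norm_of_nonneg hs.1]
      exact mul_le_of_le_one_left (norm_nonneg _) hs.2
    rcases eq_or_ne k i with rfl | hki
    · exact .inl (hk.trans hsE)
    · right
      have h1 := hd k hki
      have h2 := norm_sub_le_norm_sub_add_norm_sub (d i) (lam s) (d k)
      rw [norm_sub_rev (d i) (lam s)] at h2
      linarith
  by_contra! hc
  have hη : η - ‖E‖ ≤ ‖lam t - d i‖ := (hgap t ht).resolve_left hc.not_ge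
  have hcont : ContinuousOn (fun s => ‖lam s - d i‖) (Set.Icc 0 t) :=
    ((h.continuousOn.mono (Set.Icc_subset_Icc_right ht.2)).sub continuousOn_const).norm
  -- The radius `η / 2` lies strictly between `‖E‖` and `η - ‖E‖`; leaving the inner disc would make
  -- the path cross it.
  have hmem : η / 2 ∈ Set.Icc ‖lam 0 - d i‖ ‖lam t - d i‖ := by
    rw [h.initial, sub_self, norm_zero]
    constructor <;> linarith [norm_nonneg E]
  obtain ⟨s, hs, hs'⟩ := intermediate_value_Icc ht.1 hcont hmem
  simp only at hs'
  rcases hgap s ⟨hs.1, hs.2.trans ht.2⟩ with h1 | h1 <;> linarith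

/-- Solves `δ = t (E w(t, δ)) i` by contraction, where `w(t, δ)` is the reduced solution. Uniformity
in `t` makes the fixed point continuous in `t`. -/
theorem exists_isPerturbedEigenvalue {n : ℕ} {d : Fin n → ℂ} {E B : Matrix (Fin n) (Fin n) ℂ}
    {i : Fin n} {η κ : ℝ} (hη : 0 < η) (hd : ∀ k, k ≠ i → η ≤ ‖d i - d k‖)
    (hE : E = Matrix.diagonal d * B - B * Matrix.diagonal d)
    (hκη : 2 * ‖E‖ = κ * η) (hκ1 : κ < 1)
    (hrc : euclNorm (B i) * euclNorm (fun k => B k i) < (1 - κ) ^ 2) :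
    ∃ lam : ℝ → ℂ, IsPerturbedEigenvalue d E i lam := by
  set row := euclNorm (B i)
  set col := euclNorm (fun k => B k i)
  have hrow : 0 ≤ row := euclNorm_nonneg _
  have hcol : 0 ≤ col := euclNorm_nonneg _
  have hκ0 : 0 ≤ κ := by
    by_contra! hc
    nlinarith [norm_nonneg E]
  have hnorm : ∀ t ∈ Set.Icc (0 : ℝ) 1, ‖(t : ℂ)‖ ≤ 1 := fun t ht => by
    rw [Complex.norm_real, Real.norm_of_nonneg ht.1]; exact ht.2
  have hκ : ∀ t ∈ Set.Icc (0 : ℝ) 1, ∀ δ ∈ Metric.closedBall (0 : ℂ) ‖E‖,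
      ‖δ‖ + ‖(t : ℂ)‖ * ‖E‖ ≤ κ * η := fun t ht δ hδ => by
    have := mul_le_of_le_one_left (norm_nonneg E) (hnorm t ht)
    linarith [mem_closedBall_zero_iff.1 hδ]
  have hlt : κ * η < η := by nlinarith
  have hsol : ∀ t ∈ Set.Icc (0 : ℝ) 1, ∀ δ ∈ Metric.closedBall (0 : ℂ) ‖E‖,
      IsReducedSolution d E i t δ (fun k => t * E k i) (reducedVector d E i t δ) :=
    fun t ht δ hδ => isReducedSolution_reducedVector hη hd ((hκ t ht δ hδ).trans_lt hlt)
  let F : ℝ → ℂ → ℂ := fun t δ => t * E.mulVec (reducedVector d E i t δ) i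
  have hFle : ∀ t ∈ Set.Icc (0 : ℝ) 1, ∀ δ, ‖F t δ‖ ≤ ‖E.mulVec (reducedVector d E i t δ) i‖ :=
    fun t ht δ => (norm_mul _ _).le.trans (mul_le_of_le_one_left (norm_nonneg _) (hnorm t ht))
  have hmaps : ∀ t ∈ Set.Icc (0 : ℝ) 1,
      Set.MapsTo (F t) (Metric.closedBall 0 ‖E‖) (Metric.closedBall 0 ‖E‖) := by
    intro t ht δ hδ
    obtain ⟨h1, h2, -⟩ :=
      (hsol t ht δ hδ).norm_mulVec_apply_le hη hd hκ0 hκ1 (hκ t ht δ hδ) hE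
    rw [mem_closedBall_zero_iff]
    refine (hFle t ht δ).trans ?_
    set x := ‖E.mulVec (reducedVector d E i t δ) i‖
    have h1' : (1 - κ) * x ≤ ‖E‖ * row :=
      h1.trans (mul_le_of_le_one_left (by positivity) (hnorm t ht))
    have h2' : (1 - κ) * x ≤ ‖E‖ * col :=
      h2.trans (mul_le_of_le_one_left (by positivity) (hnorm t ht))
    -- If `x > ‖E‖`, the row and column bounds give `1 - κ ≤ row` and `1 - κ ≤ col`, against `row *
    -- col < (1 - κ)²`.
    by_contra! hc
    have hx : 0 < x := (norm_nonneg E).trans_lt hc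
    have h3 : 1 - κ ≤ row := by
      refine le_of_mul_le_mul_right ?_ hx
      nlinarith
    have h4 : 1 - κ ≤ col := by
      refine le_of_mul_le_mul_right ?_ hx
      nlinarith
    nlinarith
  have hq0 : 0 ≤ row * col / (1 - κ) ^ 2 := by positivity
  have hlip : ∀ t ∈ Set.Icc (0 : ℝ) 1,
      LipschitzOnWith (row * col / (1 - κ) ^ 2).toNNReal (F t) (Metric.closedBall 0 ‖E‖) := by
    intro t ht
    refine LipschitzOnWith.of_dist_le_mul fun δ hδ δ' hδ' => ?_
    rw [Real.coe_toNNReal _ hq0, div_mul_eq_mul_div, le_div_iff₀ (by nlinarith)]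
    set w := reducedVector d E i t δ
    set w' := reducedVector d E i t δ'
    -- The difference `w - w'` has right hand side `(δ' - δ) w'`. Its weighted norm pairs with the
    -- row of `B`, while `w'` is bounded by the column; each costs one factor `1/(1 - κ)`.
    have h1 := ((hsol t ht δ hδ).sub (hsol t ht δ' hδ')).euclNorm_mul_le hη hd hκ0 (hκ t ht δ hδ)
    rw [euclNorm_smul, ← dist_eq_norm, dist_comm δ' δ] at h1
    have h2 := ((hsol t ht δ' hδ').norm_mulVec_apply_le hη hd hκ0 hκ1 (hκ t ht δ' hδ') hE).2.2
    have h2' := h2.trans (mul_le_of_le_one_left hcol (hnorm t ht))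
    have h3 := norm_dotProduct_le (B i) fun k => (d i - d k) * (w - w') k
    rw [← commutator_diagonal_mulVec_apply hE] at h3
    have h4 : dist (F t δ) (F t δ') ≤ ‖E.mulVec (w - w') i‖ := by
      have : F t δ - F t δ' = t * E.mulVec (w - w') i := by
        simp only [F, Matrix.mulVec_sub, Pi.sub_apply]
        ring
      rw [dist_eq_norm, this, norm_mul]
      exact mul_le_of_le_one_left (norm_nonneg _) (hnorm t ht)
    have hκ' : 0 ≤ 1 - κ := by linarith
    calc dist (F t δ) (F t δ') * (1 - κ) ^ 2
        ≤ row * euclNorm (fun k => (d i - d k) * (w - w') k) * (1 - κ) ^ 2 := by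
          gcongr
          exact h4.trans h3
      _ = row * (1 - κ) * ((1 - κ) * euclNorm (fun k => (d i - d k) * (w - w') k)) := by ring
      _ ≤ row * (1 - κ) * (dist δ δ' * euclNorm w') := by gcongr
      _ = row * dist δ δ' * ((1 - κ) * euclNorm w') := by ring
      _ ≤ row * dist δ δ' * col := by gcongr
      _ = row * col * dist δ δ' := by ring
  have hcont : ∀ δ ∈ Metric.closedBall (0 : ℂ) ‖E‖,
      ContinuousOn (fun t => F t δ) (Set.Icc 0 1) := by
    intro δ hδ
    have h1 : ContinuousOn (fun t : ℝ => reducedVector d E i t δ) (Set.Icc 0 1) :=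
      (continuousOn_reducedVector hη hd (K := (fun t : ℝ => (t : ℂ)) '' Set.Icc 0 1) (by
        rintro _ ⟨t, ht, rfl⟩
        exact (hκ t ht δ hδ).trans_lt hlt)).comp Complex.continuous_ofReal.continuousOn
        (Set.mapsTo_image _ _)
    have h2 : Continuous fun w : Fin n → ℂ => E.mulVec w i := by fun_prop
    exact Complex.continuous_ofReal.continuousOn.mul (h2.comp_continuousOn h1)
  have hq1 : (row * col / (1 - κ) ^ 2).toNNReal < 1 := by
    rw [Real.toNNReal_lt_one, div_lt_one (by nlinarith)]
    exact hrc
  obtain ⟨x, hx, hfix⟩ := exists_continuousOn_fixedPoint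
    (Metric.isClosed_closedBall (x := (0 : ℂ)) (ε := ‖E‖)).isComplete
    ⟨0, by simp⟩ hq1 F hmaps hlip hcont
  refine ⟨fun t => d i + x t, continuousOn_const.add hx, ?_, fun t ht => ?_⟩
  · have := (hfix 0 (by simp)).2
    simp only [F, Complex.ofReal_zero, zero_mul] at this
    rw [← this, add_zero]
  · exact hasEigenvalue_of_isReducedSolution (by rw [commutator_diagonal_apply hE]; simp)
      (hsol t ht _ (hfix t ht).1) (hfix t ht).2

/-- Every perturbed eigenvalue stays close to `d i` to second order in the perturbation. -/
theorem IsPerturbedEigenvalue.norm_sub_le_sq {n : ℕ} {d : Fin n → ℂ}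
    {E B : Matrix (Fin n) (Fin n) ℂ} {i : Fin n} {η κ : ℝ} {lam : ℝ → ℂ} (hη : 0 < η)
    (hd : ∀ k, k ≠ i → η ≤ ‖d i - d k‖)
    (hE : E = Matrix.diagonal d * B - B * Matrix.diagonal d)
    (hκη : 2 * ‖E‖ = κ * η) (hκ1 : κ < 1)
    (h : IsPerturbedEigenvalue d E i lam) {t : ℝ} (ht : t ∈ Set.Icc (0 : ℝ) 1) :
    (1 - κ) * ‖lam t - d i‖ ≤ t ^ 2 * ‖E‖ * ((euclNorm (B i) + euclNorm (fun k => B k i)) / 2) := by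
  have h1 := h.norm_sub_le hd (by nlinarith) ht
  have hκ0 : 0 ≤ κ := by
    by_contra! hc
    nlinarith [norm_nonneg E]
  have hnt : ‖(t : ℂ)‖ = t := by rw [Complex.norm_real, Real.norm_of_nonneg ht.1]
  obtain ⟨h2, h3⟩ := norm_eigenvalue_sub_le hη hd hκ0 hκ1 (by
    have := mul_le_of_le_one_left (norm_nonneg E) (hnt.trans_le ht.2)
    linarith) hE (h.eigenvalue t ht)
  rw [hnt] at h2 h3
  linarith

/-- For `n ≠ 1` the number `η` is the spectral gap; for `n = 1`, where `E = 0`, it is `1`. -/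
theorem exists_gap {n : ℕ} {d : Fin n → ℂ} (hd : Function.Injective d)
    {E B : Matrix (Fin n) (Fin n) ℂ} (hE : E = Matrix.diagonal d * B - B * Matrix.diagonal d)
    (i : Fin n) :
    ∃ η : ℝ, 0 < η ∧ (∀ k, k ≠ i → η ≤ ‖d i - d k‖) ∧ ‖E‖ / spectralGap d i = ‖E‖ / η := by
  rcases isEmpty_or_nonempty {j : Fin n // j ≠ i} with hem | hne
  · have hk : ∀ k, k = i := fun k => by
      by_contra hk
      exact hem.elim ⟨k, hk⟩
    have hE0 : E = 0 := by
      ext j k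
      rw [commutator_diagonal_apply hE, hk j, hk k]
      simp
    -- Both quotients vanish because `E = 0`, whatever value the empty infimum takes.
    exact ⟨1, one_pos, fun k h => absurd (hk k) h, by simp [hE0]⟩
  · refine ⟨spectralGap d i, ?_, fun k hk => ?_, rfl⟩
    · obtain ⟨⟨k, hk⟩, hmin⟩ :=
        exists_eq_ciInf_of_finite (f := fun j : {j : Fin n // j ≠ i} => ‖d i - d j‖)
      rw [spectralGap, ← hmin]
      exact norm_pos_iff.2 (sub_ne_zero.2 fun h => hk (hd h).symm)
    · exact ciInf_le (f := fun j : {j : Fin n // j ≠ i} => ‖d i - d j‖)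
        (Set.finite_range _).bddBelow ⟨k, hk⟩

/-! ### Row and column of `B` bounded by `‖E‖ / η` -/

section Commutator

variable {ι : Type*} [Fintype ι] [DecidableEq ι] {d : ι → ℂ} {E B : Matrix ι ι ℂ} {i : ι} {η : ℝ}

theorem euclNorm_row_le_div (hη : 0 < η) (hd : ∀ k, k ≠ i → η ≤ ‖d i - d k‖)
    (hE : E = Matrix.diagonal d * B - B * Matrix.diagonal d) (hB : B i i = 0) :
    euclNorm (B i) ≤ ‖E‖ / η := by
  have h : euclNorm (B i) ≤ η⁻¹ * euclNorm (E i) := by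
    refine euclNorm_le_mul (by positivity) fun k => ?_
    rw [inv_mul_eq_div, le_div_iff₀ hη, commutator_diagonal_apply hE, norm_mul, mul_comm]
    rcases eq_or_ne k i with rfl | hk
    · simp [hB]
    · exact mul_le_mul_of_nonneg_right (hd k hk) (norm_nonneg _)
  rw [div_eq_inv_mul]
  exact h.trans (by gcongr; exact euclNorm_row_le E i)

theorem euclNorm_col_le_div (hη : 0 < η) (hd : ∀ k, k ≠ i → η ≤ ‖d i - d k‖)
    (hE : E = Matrix.diagonal d * B - B * Matrix.diagonal d) (hB : B i i = 0) :
    euclNorm (fun k => B k i) ≤ ‖E‖ / η := by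
  have h : euclNorm (fun k => B k i) ≤ η⁻¹ * euclNorm (fun k => E k i) := by
    refine euclNorm_le_mul (by positivity) fun k => ?_
    rw [inv_mul_eq_div, le_div_iff₀ hη, commutator_diagonal_apply hE, norm_mul, mul_comm]
    rcases eq_or_ne k i with rfl | hk
    · simp [hB]
    · rw [norm_sub_rev (d k)]
      exact mul_le_mul_of_nonneg_right (hd k hk) (norm_nonneg _)
  rw [div_eq_inv_mul]
  exact h.trans (by gcongr; exact euclNorm_col_le E i)

end Commutator

/-! ### The stated bounds -/

theorem mainTheorem1 {n : ℕ} (d : Fin n → ℂ) (hd : Function.Injective d)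
    (E B : Matrix (Fin n) (Fin n) ℂ)
    (hE : E = Matrix.diagonal d * B - B * Matrix.diagonal d)
    (hB : ∀ j, B j j = 0)
    (i : Fin n) (η ρ row col : ℝ)
    (hη : η = spectralGap d i) (hρ : ρ = ‖E‖ / η)
    (hrow : row = rowNorm B i) (hcol : col = colNorm B i) :
    -- the bound in terms of the row and the column of `B`, when its denominators are positive
    (0 < 1 - 2 * ‖E‖ / η →
      0 < 1 - 2 * ‖E‖ / η - row * col / (1 - 2 * ‖E‖ / η) →
      (∃ lam : ℝ → ℂ, IsPerturbedEigenvalue d E i lam) ∧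
      ∀ lam : ℝ → ℂ, IsPerturbedEigenvalue d E i lam → ∀ t ∈ Set.Icc (0 : ℝ) 1,
        ‖lam t - d i‖ ≤
          (t ^ 2 * ‖E‖ * ((row + col) / 2)
              + t ^ 3 * ‖E‖ * row * col / (3 * (1 - 2 * ‖E‖ / η)))
            / (1 - 2 * ‖E‖ / η - row * col / (1 - 2 * ‖E‖ / η))) ∧
    -- the simplified bounds, when their denominators are positive
    (0 < 1 - 2 * ρ →
      0 < 1 - 2 * ρ - ρ ^ 2 / (1 - 2 * ρ) →
      (0 < 1 - 2 * ‖E‖ / η - row * col / (1 - 2 * ‖E‖ / η)) ∧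
      (∀ t ∈ Set.Icc (0 : ℝ) 1,
        (t ^ 2 * ‖E‖ * ((row + col) / 2)
              + t ^ 3 * ‖E‖ * row * col / (3 * (1 - 2 * ‖E‖ / η)))
            / (1 - 2 * ‖E‖ / η - row * col / (1 - 2 * ‖E‖ / η)) ≤
          t ^ 2 * ‖E‖ * (ρ + t / 3 * (ρ ^ 2 / (1 - 2 * ρ)))
            / (1 - 2 * ρ - ρ ^ 2 / (1 - 2 * ρ))) ∧
      ∀ lam : ℝ → ℂ, IsPerturbedEigenvalue d E i lam → ∀ t ∈ Set.Icc (0 : ℝ) 1,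
        ‖lam t - d i‖ ≤
          t ^ 2 * ‖E‖ * (ρ + t / 3 * (ρ ^ 2 / (1 - ρ)))
            / (1 - 2 * ρ - ρ ^ 2 / (1 - 2 * ρ))) ∧
    -- the perturbation is of order `‖E‖ ^ 2 / η`, uniformly for `ρ ≤ r < 1 / 3`
    (∀ r : ℝ, ρ ≤ r → r < 1 / 3 →
      ∀ lam : ℝ → ℂ, IsPerturbedEigenvalue d E i lam → ∀ t ∈ Set.Icc (0 : ℝ) 1,
        ‖lam t - d i‖ ≤
          (1 + 1 / 3 * (r / (1 - r))) / (1 - 2 * r - r ^ 2 / (1 - 2 * r))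
            * (t ^ 2 * (‖E‖ ^ 2 / η))) := by
  obtain ⟨η', hη', hgap, hdiv⟩ := exists_gap hd hE i
  rw [← hη] at hdiv
  have hρ' : ρ = ‖E‖ / η' := hρ.trans hdiv
  have h2ρ : 2 * ‖E‖ / η = 2 * ρ := by rw [hρ, mul_div_assoc]
  have hκη : 2 * ‖E‖ = 2 * ρ * η' := by rw [hρ']; field_simp
  have hsq : ‖E‖ ^ 2 / η = ‖E‖ * ρ := by rw [hρ]; ring
  have hrow' : row = euclNorm (B i) := hrow
  have hcol' : col = euclNorm (fun k => B k i) := hcol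
  have hr0 : 0 ≤ row := hrow' ▸ euclNorm_nonneg _
  have hc0 : 0 ≤ col := hcol' ▸ euclNorm_nonneg _
  have hrρ : row ≤ ρ := by
    rw [hrow', hρ']; exact euclNorm_row_le_div hη' hgap hE (hB i)
  have hcρ : col ≤ ρ := by
    rw [hcol', hρ']; exact euclNorm_col_le_div hη' hgap hE (hB i)
  have hρ0 : 0 ≤ ρ := hr0.trans hrρ
  have hrcρ : row * col ≤ ρ ^ 2 := by nlinarith
  have he : 0 ≤ ‖E‖ := norm_nonneg E
  have key : 0 < 1 - 2 * ρ → ∀ lam : ℝ → ℂ, IsPerturbedEigenvalue d E i lam →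
      ∀ t ∈ Set.Icc (0 : ℝ) 1,
        ‖lam t - d i‖ ≤ t ^ 2 * ‖E‖ * ((row + col) / 2) / (1 - 2 * ρ) := by
    intro h1 lam hlam t ht
    rw [le_div_iff₀ h1, mul_comm, hrow', hcol']
    exact hlam.norm_sub_le_sq hη' hgap hE hκη (by linarith) ht
  have key' : 0 < 1 - 2 * ρ → ∀ lam : ℝ → ℂ, IsPerturbedEigenvalue d E i lam →
      ∀ t ∈ Set.Icc (0 : ℝ) 1, ‖lam t - d i‖ ≤ t ^ 2 * ‖E‖ * ρ / (1 - 2 * ρ) := by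
    intro h1 lam hlam t ht
    refine (key h1 lam hlam t ht).trans ?_
    gcongr
    linarith
  rw [h2ρ, hsq]
  refine ⟨fun h1 h2 => ⟨?_, fun lam hlam t ht => (key h1 lam hlam t ht).trans ?_⟩,
    fun h1 h2 => ⟨?_, fun t ht => ?_, fun lam hlam t ht => (key' h1 lam hlam t ht).trans ?_⟩,
    fun r hr hr3 lam hlam t ht => ?_⟩
  · refine exists_isPerturbedEigenvalue hη' hgap hE hκη (by linarith) ?_
    rw [← hrow', ← hcol']
    -- Multiplied by `1 - 2ρ`, the hypothesis is the contraction condition.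
    rw [sub_pos, div_lt_iff₀ h1] at h2
    linarith
  · have ht0 := ht.1
    have : 0 ≤ row * col / (1 - 2 * ρ) := by positivity
    refine div_le_div₀ (by positivity) (le_add_of_nonneg_right (by positivity)) h2 (by linarith)
  · have : row * col / (1 - 2 * ρ) ≤ ρ ^ 2 / (1 - 2 * ρ) := by gcongr
    linarith
  · have ht0 := ht.1
    have h3 : row * col / (1 - 2 * ρ) ≤ ρ ^ 2 / (1 - 2 * ρ) := by gcongr
    refine div_le_div₀ (by positivity) ?_ h2 (by linarith)
    have h4 : t ^ 3 * ‖E‖ * row * col / (3 * (1 - 2 * ρ)) =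
        t ^ 2 * ‖E‖ * (t / 3 * (row * col / (1 - 2 * ρ))) := by
      field_simp
    rw [h4, ← mul_add]
    gcongr
    linarith
  · have ht0 := ht.1
    have h3 : 0 < 1 - ρ := by linarith
    have h4 : 0 ≤ ρ ^ 2 / (1 - 2 * ρ) := by positivity
    refine div_le_div₀ (by positivity) ?_ h2 (by linarith)
    gcongr
    exact le_add_of_nonneg_right (by positivity)
  · have h1 : 0 < 1 - 2 * r := by linarith
    have h1' : 0 < 1 - r := by linarith
    have hr0 : 0 ≤ r := hρ0.trans hr
    have h2 : 0 < 1 - 2 * r - r ^ 2 / (1 - 2 * r) := by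
      -- The claim is `r² < (1 - 2r)²`, that is `r < 1 - 2r`.
      rw [sub_pos, div_lt_iff₀ h1]
      nlinarith
    have h3 : 0 ≤ r ^ 2 / (1 - 2 * r) := by positivity
    refine (key' (by linarith) lam hlam t ht).trans ?_
    rw [mul_assoc, div_eq_mul_one_div, mul_comm]
    refine mul_le_mul_of_nonneg_right ?_ (by positivity)
    exact div_le_div₀ (by positivity) (le_add_of_nonneg_right (by positivity)) h2 (by linarith)
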